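/- Let $t_0\ge 0$, $m\in\mathbb N$, $\sigma>0$ and $\tau_1,\dots,\tau_m>0$. Consider the scalar neutral equation $$\dot x(t)-a(t)\,\dot x(g(t))=\sum_{k=1}^m b_k(t)\,x(h_k(t)),\qquad t\ge t_0, \tag{E}$$ where $a,g,b_k,h_k:[t_0,\infty)\to\mathbb R$ are Lebesgue measurable, $a$ and the $b_k$ are essentially bounded, $|a(t)|\le a_0$ for almost all $t\ge t_0$ with a constant $a_0<1$, $0\le t-g(t)\le\sigma$ and $0\le t-h_k(t)\le\tau_k$ for all $t\ge t_0$, and $g^{-1}(U)$ has Lebesgue measure zero whenever $U$ has. For an initial point $s\ge t_0$ and bounded Borel measurable functions $\Phi:[s-\max_k\tau_k,s]\to\mathbb R$ and $\Psi:[s-\sigma,s)\to\mathbb R$, a solution of the initial value problem is a function $x$ which is locally absolutely continuous on $[s,\infty)$ with locally essentially bounded derivative on $[s,\infty)$, equals $\Phi$ on $[s-\max_k\tau_k,s]$, and satisfies (E) for almost all $t\ge s$, where $\dot x(g(t))$ is read as $\Psi(g(t))$ if $g(t)<s$. Equation (E) is uniformly exponentially stable if there are constants $M,\gamma>0$ such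 that for all $s\ge t_0$, all such $\Phi,\Psi$ and every solution $x$, $$|x(t)|\le M e^{-\gamma(t-s)}\Bigl[\sup_{r\in[s-\max_k\tau_k,\,s]}|\Phi(r)|+\operatorname*{ess\,sup}_{r\in[s-\sigma,\,s)}|\Psi(r)|\Bigr],\qquad t\ge s.$$ Write $\|f\|=\operatorname{ess\,sup}_{t\ge t_0}|f(t)|$ and $b(t)=\sum_{k=1}^m b_k(t)$. Assume that for some $\beta>0$ we have $b(t)\le-\beta$ for almost all $t\ge t_0$, and that either $$\sum_{k=1}^m\|b_k\|\left(\left\|\frac ab\right\|+\sum_{k=1}^m\tau_k\left\|\frac{b_k}{b}\right\|\right)<1-\|a\|$$ or $$\|b\|\left(\left\|\frac ab\right\|+\sum_{k=1}^m\tau_k\left\|\frac{b_k}{b}\right\|\right)<1-\|a\|-\sum_{k=1}^m\tau_k\|b_k\|.$$ Then equation (E) is uniformly exponentially stable. -/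

import Mathlib

open MeasureTheory Set

noncomputable section

/-- The data of the scalar neutral equation
`x'(t) - a(t) x'(g(t)) = ∑ k, b k (t) * x(h k (t))`, `t ≥ t₀`, together with the bounds
`σ` and `τ k` for the delays `t - g(t)` and `t - h k (t)`. -/
structure NeutralEq (m : ℕ) where
  t₀ : ℝ
  a : ℝ → ℝ
  g : ℝ → ℝ
  b : Fin m → ℝ → ℝ
  h : Fin m → ℝ → ℝ
  σ : ℝ
  τ : Fin m → ℝ

namespace NeutralEq

variable {m : ℕ}

/-- The standing assumptions on the equation. All functions matter only on `[t₀, ∞)`;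
`AEMeasurable` with respect to Lebesgue measure is Lebesgue measurability. -/
structure Admissible (E : NeutralEq m) : Prop where
  t₀_nonneg : 0 ≤ E.t₀
  σ_pos : 0 < E.σ
  τ_pos : ∀ k, 0 < E.τ k
  a_meas : AEMeasurable E.a (volume.restrict (Ici E.t₀))
  g_meas : AEMeasurable E.g (volume.restrict (Ici E.t₀))
  b_meas : ∀ k, AEMeasurable (E.b k) (volume.restrict (Ici E.t₀))
  h_meas : ∀ k, AEMeasurable (E.h k) (volume.restrict (Ici E.t₀))
  a_bound : ∃ a₀ : ℝ, a₀ < 1 ∧ ∀ᵐ t ∂volume.restrict (Ici E.t₀), |E.a t| ≤ a₀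
  b_bound : ∀ k, ∃ C : ℝ, ∀ᵐ t ∂volume.restrict (Ici E.t₀), |E.b k t| ≤ C
  g_delay : ∀ t, E.t₀ ≤ t → 0 ≤ t - E.g t ∧ t - E.g t ≤ E.σ
  h_delay : ∀ k, ∀ t, E.t₀ ≤ t → 0 ≤ t - E.h k t ∧ t - E.h k t ≤ E.τ k
  g_null : ∀ U : Set ℝ, volume U = 0 → volume {t | E.t₀ ≤ t ∧ E.g t ∈ U} = 0

/-- The sum `b = ∑ k, b k` of the coefficients of the non-neutral part. -/
def bSum (E : NeutralEq m) (t : ℝ) : ℝ := ∑ k, E.b k t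

/-- The essential supremum norm of `f` on `[t₀, ∞)`. -/
def supNorm (E : NeutralEq m) (f : ℝ → ℝ) : ℝ :=
  essSup (fun t => |f t|) (volume.restrict (Ici E.t₀))

/-- The largest of the delay bounds `τ k`. -/
def τmax (E : NeutralEq m) : ℝ := ⨆ k, E.τ k

/-- Initial functions at the initial point `s`: `Φ` on `[s - max τ, s]` prescribes `x`, and `Ψ` on
`[s - σ, s)` prescribes `x'`. Both are bounded and Borel measurable; `Ψ` need not be the derivative
of `Φ`. Their values off these intervals play no role. -/
structure IsInitial (E : NeutralEq m) (s : ℝ) (Φ Ψ : ℝ → ℝ) : Prop where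
  Φ_meas : Measurable (fun t : Icc (s - E.τmax) s => Φ t)
  Ψ_meas : Measurable (fun t : Ico (s - E.σ) s => Ψ t)
  Φ_bound : ∃ C : ℝ, ∀ t ∈ Icc (s - E.τmax) s, |Φ t| ≤ C
  Ψ_bound : ∃ C : ℝ, ∀ t ∈ Ico (s - E.σ) s, |Ψ t| ≤ C

/-- The function written `x'` in the equation: the prescribed `Ψ` before the initial point `s`, the
derivative of `x` from `s` on. -/
def xdot (s : ℝ) (Ψ x : ℝ → ℝ) (t : ℝ) : ℝ := if t < s then Ψ t else deriv x t

/-- `x` solves the initial value problem with initial point `s` and initial functions `Φ`, `Ψ`: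
it is locally absolutely continuous on `[s, ∞)` with locally essentially bounded derivative,
agrees with `Φ` on the initial interval, and satisfies the equation almost everywhere. -/
structure IsSolution (E : NeutralEq m) (s : ℝ) (Φ Ψ x : ℝ → ℝ) : Prop where
  absCont : ∀ c, s < c → AbsolutelyContinuousOnInterval x s c
  deriv_bound : ∀ c, s < c → ∃ C : ℝ, ∀ᵐ t ∂volume.restrict (Icc s c), |deriv x t| ≤ C
  initial : ∀ t ∈ Icc (s - E.τmax) s, x t = Φ t
  equation : ∀ᵐ t ∂volume.restrict (Ici s),
    xdot s Ψ x t - E.a t * xdot s Ψ x (E.g t) = ∑ k, E.b k t * x (E.h k t)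

/-- Uniform exponential stability: one pair `M, γ` serves all initial points `s ≥ t₀` and all
initial functions. The supremum of `Φ` is the pointwise one, that of `Ψ` the essential one. -/
def UniformlyExponentiallyStable (E : NeutralEq m) : Prop :=
  ∃ M γ : ℝ, 0 < M ∧ 0 < γ ∧
    ∀ s, E.t₀ ≤ s → ∀ Φ Ψ x : ℝ → ℝ, E.IsInitial s Φ Ψ → E.IsSolution s Φ Ψ x →
      ∀ t, s ≤ t →
        |x t| ≤ M * Real.exp (-γ * (t - s)) *
          ((⨆ r : Icc (s - E.τmax) s, |Φ r|) +
            essSup (fun r => |Ψ r|) (volume.restrict (Ico (s - E.σ) s)))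

end NeutralEq

end

open MeasureTheory Set Filter Topology

/-! The proof bootstraps a bound `C` for `|x'(t)| e^{γ(t-s)}` on a finite interval. Dropping the
delays turns (E) into `x' = b x` plus an error; dividing the error by `|b|` leaves the ratios `a/b`,
`b_k/b`. As `b ≤ -β`, comparison with an exponential
(`AbsolutelyContinuousOnInterval.abs_le_exp_of_ae_abs_deriv_sub_le`) gives `x` a weighted bound
about `(‖a/b‖ + ∑ τ_k ‖b_k/b‖) C` plus a multiple of the size `S` of the initial data
(`HasDerivDecay.abs_le`).

Feeding this back into the equation bounds `x'` anew by `θ C + η S`. The two alternatives of the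
hypothesis are two ways to do so: estimate each `b_k x(h_k)` directly, or write `x' = b x` plus
error and estimate that. At rate `γ = 0` the respective assumption says `θ < 1`; by continuity this
persists for a small `γ > 0` (`exists_rate`).

Since `x'` is bounded on the finite interval, some `C` is available, and iteration
(`ae_le_mul_of_contraction`) replaces it by `η S / (1 - θ)`, which depends neither on the interval
nor on the solution. -/

/-! ### Comparison with exponentials and the contraction argument. -/

/-- The fundamental theorem of calculus bounds the increment of an absolutely continuous function
whose derivative decays exponentially. -/
theorem AbsolutelyContinuousOnInterval.abs_sub_le_of_ae_abs_deriv_le_exp {x : ℝ → ℝ}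
    {s T C γ u t : ℝ} (hx : AbsolutelyContinuousOnInterval x s T) (hγ : 0 ≤ γ) (hC : 0 ≤ C)
    (hd : ∀ᵐ r ∂volume.restrict (Icc s T), |deriv x r| ≤ C * Real.exp (-γ * (r - s)))
    (hsu : s ≤ u) (hut : u ≤ t) (htT : t ≤ T) :
    |x t - x u| ≤ C * Real.exp (-γ * (u - s)) * (t - u) := by
  have hsub : uIcc u t ⊆ uIcc s T := by
    rw [uIcc_of_le hut, uIcc_of_le (hsu.trans (hut.trans htT))]
    exact Icc_subset_Icc hsu htT
  rw [← (hx.mono hsub).integral_deriv_eq_sub, ← abs_of_nonneg (sub_nonneg.2 hut)]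
  refine intervalIntegral.norm_integral_le_of_norm_le_const_ae (E := ℝ) ?_
  rw [ae_restrict_iff' measurableSet_Icc] at hd
  filter_upwards [hd] with r hr hrm
  rw [uIoc_of_le hut] at hrm
  refine (hr ⟨hsu.trans hrm.1.le, hrm.2.trans htT⟩).trans ?_
  refine mul_le_mul_of_nonneg_left (Real.exp_le_exp.2 ?_) hC
  nlinarith [hrm.1]

/-- One-sided comparison of a solution of `x' ≤ p x + |p| K e^{-γ(t-s)}`, `p ≤ -β`, with a decaying
exponential. -/
theorem AbsolutelyContinuousOnInterval.le_exp_of_ae_deriv_le {x p : ℝ → ℝ}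
    {s T γ β K N : ℝ} (hx : AbsolutelyContinuousOnInterval x s T)
    (hp : ∀ᵐ t ∂volume.restrict (Icc s T), p t ≤ -β)
    (hd : ∀ᵐ t ∂volume.restrict (Icc s T),
      deriv x t ≤ p t * x t + |p t| * (K * Real.exp (-γ * (t - s))))
    (hβ : 0 ≤ β) (hK : K ≤ N) (hN : γ * N ≤ β * (N - K)) (h0 : x s ≤ N) :
    ∀ t ∈ Icc s T, x t ≤ N * Real.exp (-γ * (t - s)) := by
  intro t₁ ht₁
  by_contra! hlt
  have hsT : s ≤ T := ht₁.1.trans ht₁.2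
  set e : ℝ → ℝ := fun t => N * Real.exp (-γ * (t - s)) with he
  have hec : Continuous e := by fun_prop
  have hxc : ContinuousOn x (Icc s t₁) := by
    have := hx.continuousOn
    rw [uIcc_of_le hsT] at this
    exact this.mono (Icc_subset_Icc_right ht₁.2)
  have hcl : IsCompact {t ∈ Icc s t₁ | x t ≤ e t} := by
    refine isCompact_Icc.of_isClosed_subset ?_ (fun t ht => ht.1)
    exact isClosed_Icc.isClosed_le hxc hec.continuousOn
  -- At the last time `t₀` with `x ≤ e`, compare increments: on `(t₀, t₁]` the function `x` lies
  -- above `e`, which forces `x' ≤ e'` there and contradicts `x t₁ > e t₁`.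
  obtain ⟨t₀, ⟨ht₀, hxt₀⟩, hmax⟩ :=
    hcl.exists_isGreatest ⟨s, ⟨le_rfl, ht₁.1⟩, by simpa [he] using h0⟩
  have hsub : uIcc t₀ t₁ ⊆ uIcc s T := by
    rw [uIcc_of_le ht₀.2, uIcc_of_le hsT]
    exact Icc_subset_Icc ht₀.1 ht₁.2
  have hder : ∀ t, HasDerivAt e (-γ * e t) t := by
    intro t
    have h := ((((hasDerivAt_id t).sub_const s).const_mul (-γ)).exp).const_mul N
    exact h.congr_deriv (by simp only [he, id]; ring)
  have hint : IntervalIntegrable (fun t => -γ * e t) volume t₀ t₁ :=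
    (hec.const_mul (-γ)).intervalIntegrable _ _
  have key : ∫ t in t₀..t₁, deriv x t ≤ ∫ t in t₀..t₁, -γ * e t := by
    refine intervalIntegral.integral_mono_ae_restrict ht₀.2
      (hx.mono hsub).intervalIntegrable_deriv hint ?_
    have hmem : ∀ᵐ t ∂volume.restrict (Icc t₀ t₁), t ∈ Icc t₀ t₁ :=
      ae_restrict_mem measurableSet_Icc
    have hne : ∀ᵐ t ∂volume.restrict (Icc t₀ t₁), t ≠ t₀ :=
      ae_restrict_of_ae (by simp [ae_iff])
    have hss : Icc t₀ t₁ ⊆ Icc s T := Icc_subset_Icc ht₀.1 ht₁.2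
    filter_upwards [hmem, hne, ae_restrict_of_ae_restrict_of_subset hss hp,
      ae_restrict_of_ae_restrict_of_subset hss hd] with t ht htne hpt hdt
    have hxe : e t < x t := by
      by_contra! hle
      exact htne (le_antisymm (hmax ⟨⟨ht₀.1.trans ht.1, ht.2⟩, hle⟩) ht.1)
    refine hdt.trans ?_
    have hE := Real.exp_pos (-γ * (t - s))
    rw [abs_of_nonpos (by linarith)]
    -- As `p ≤ 0` and `x > e`, the right-hand side is at most `p (N - K) e^{-γ(t-s)}`, and `hN`
    -- bounds this by `e' = -γ N e^{-γ(t-s)}`.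
    have h1 : p t * x t ≤ p t * e t := by nlinarith
    have h2 : β * (N - K) ≤ -p t * (N - K) := by nlinarith
    have h3 : (γ * N) * Real.exp (-γ * (t - s))
        ≤ (-p t * (N - K)) * Real.exp (-γ * (t - s)) :=
      mul_le_mul_of_nonneg_right (hN.trans h2) hE.le
    simp only [he] at h1 ⊢
    nlinarith
  rw [(hx.mono hsub).integral_deriv_eq_sub,
    intervalIntegral.integral_eq_sub_of_hasDerivAt (fun t _ => hder t) hint] at key
  have : e t₁ < x t₁ := hlt
  linarith

/-- Two-sided comparison of a solution of `x' = p x + O(|p| K e^{-γ(t-s)})`, `p ≤ -β`, with a decaying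
exponential. -/
theorem AbsolutelyContinuousOnInterval.abs_le_exp_of_ae_abs_deriv_sub_le {x p : ℝ → ℝ}
    {s T γ β K N : ℝ} (hx : AbsolutelyContinuousOnInterval x s T)
    (hp : ∀ᵐ t ∂volume.restrict (Icc s T), p t ≤ -β)
    (hd : ∀ᵐ t ∂volume.restrict (Icc s T),
      |deriv x t - p t * x t| ≤ |p t| * (K * Real.exp (-γ * (t - s))))
    (hβ : 0 ≤ β) (hK : K ≤ N) (hN : γ * N ≤ β * (N - K)) (h0 : |x s| ≤ N) :
    ∀ t ∈ Icc s T, |x t| ≤ N * Real.exp (-γ * (t - s)) := by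
  intro t ht
  rw [abs_le]
  constructor
  · have := AbsolutelyContinuousOnInterval.le_exp_of_ae_deriv_le (x := fun t => - x t) hx.neg hp
      (by
        filter_upwards [hd] with t ht
        rw [deriv.fun_neg]
        linarith [(abs_le.1 ht).1]) hβ hK hN (by linarith [(abs_le.1 h0).1]) t ht
    linarith
  · refine hx.le_exp_of_ae_deriv_le hp ?_ hβ hK hN (by linarith [(abs_le.1 h0).2]) t ht
    filter_upwards [hd] with t ht
    linarith [(abs_le.1 ht).2]

/-- A bound `C` that may be improved to `θ C + I`, `θ < 1`, can be improved to `I / (1 - θ)`. -/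
theorem ae_le_mul_of_contraction {α : Type*} {_ : MeasurableSpace α} {μ : Measure α}
    {f w : α → ℝ} {θ I : ℝ} (hθ : 0 ≤ θ) (hθ1 : θ < 1) (hI : 0 ≤ I)
    (hex : ∃ C, 0 ≤ C ∧ ∀ᵐ t ∂μ, f t ≤ C * w t)
    (hstep : ∀ C, 0 ≤ C → (∀ᵐ t ∂μ, f t ≤ C * w t) → ∀ᵐ t ∂μ, f t ≤ (θ * C + I) * w t) :
    ∀ᵐ t ∂μ, f t ≤ I / (1 - θ) * w t := by
  obtain ⟨C, hC, hfC⟩ := hex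
  set L := I / (1 - θ) with hL
  have hfix : θ * L + I = L := by
    rw [hL]; field_simp [sub_ne_zero.2 hθ1.ne']; ring
  have hL0 : 0 ≤ L := div_nonneg hI (by linarith)
  -- The `n`-th iterate of `C ↦ θ C + I`, written around its fixed point `L`. It is a convex
  -- combination of `C` and `L`, hence nonnegative, as `hstep` requires.
  have hall : ∀ n : ℕ, ∀ᵐ t ∂μ, f t ≤ (θ ^ n * (C - L) + L) * w t := by
    intro n
    induction n with
    | zero => simpa using hfC
    | succ n ih =>
      have h1 : θ ^ n ≤ 1 := pow_le_one₀ hθ hθ1.le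
      have h0 : 0 ≤ θ ^ n := pow_nonneg hθ n
      have := hstep _ (by nlinarith) ih
      have heq : θ * (θ ^ n * (C - L) + L) + I = θ ^ (n + 1) * (C - L) + L := by
        rw [pow_succ]; linear_combination hfix
      rwa [heq] at this
  filter_upwards [ae_all_iff.2 hall] with t ht
  refine ge_of_tendsto' (x := atTop) ?_ ht
  have := (((tendsto_pow_atTop_nhds_zero_of_lt_one hθ hθ1).mul_const (C - L)).add_const L).mul_const
    (w t)
  simpa using this

/-- A function with essentially bounded modulus is bounded by its essential supremum. -/
theorem ae_abs_le_essSup {α : Type*} {_ : MeasurableSpace α} {μ : Measure α} {f : α → ℝ}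
    (hf : ∃ C : ℝ, ∀ᵐ t ∂μ, |f t| ≤ C) : ∀ᵐ t ∂μ, |f t| ≤ essSup (fun t => |f t|) μ := by
  obtain ⟨C, hC⟩ := hf
  exact ae_le_essSup (isBoundedUnder_of_eventually_le hC)

/-! ### Exponentially weighted estimates for the neutral equation. -/

namespace NeutralEq

variable {m : ℕ}

/-- The growth over the longest possible delay of the weight `e^{γ t}`. -/
noncomputable def delayFactor (E : NeutralEq m) (γ : ℝ) : ℝ := Real.exp (γ * (E.σ + ∑ k, E.τ k))

/-- On `[s, T]` the function `x` satisfies the equation and its derivative is bounded by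
`C e^{-γ(t-s)}`; the initial data are bounded by `S`. -/
structure HasDerivDecay (E : NeutralEq m) (s T γ S C : ℝ) (Ψ x : ℝ → ℝ) : Prop where
  start : E.t₀ ≤ s
  rate_nonneg : 0 ≤ γ
  data_nonneg : 0 ≤ S
  bound_nonneg : 0 ≤ C
  absCont : AbsolutelyContinuousOnInterval x s T
  initial : ∀ r ∈ Icc (s - E.τmax) s, |x r| ≤ S
  initial_deriv : ∀ᵐ r ∂volume.restrict (Ico (s - E.σ) s), |Ψ r| ≤ S
  equation : ∀ᵐ t ∂volume.restrict (Icc s T),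
    xdot s Ψ x t - E.a t * xdot s Ψ x (E.g t) = ∑ k, E.b k t * x (E.h k t)
  deriv_le : ∀ᵐ t ∂volume.restrict (Icc s T), |deriv x t| ≤ C * Real.exp (-γ * (t - s))

/-- Going back by at most `τ` raises the weight by a factor of at most `e^{γτ}`. The case `u = s`
serves delayed arguments that fall before `s`: then `t - s ≤ τ`, so `1 ≤ G e^{-γ(t-s)}` and the
initial data obey a weighted bound too. -/
theorem exp_le_mul_exp {γ G τ s t u : ℝ} (hγ : 0 ≤ γ) (hG : Real.exp (γ * τ) ≤ G)
    (h : t - u ≤ τ) : Real.exp (-γ * (u - s)) ≤ G * Real.exp (-γ * (t - s)) := by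
  refine le_trans ?_ (mul_le_mul_of_nonneg_right hG (Real.exp_pos _).le)
  rw [← Real.exp_add]
  refine Real.exp_le_exp.2 ?_
  nlinarith

namespace Admissible

variable {E : NeutralEq m} {γ : ℝ}

theorem le_τmax (_hE : E.Admissible) (k : Fin m) : E.τ k ≤ E.τmax :=
  le_ciSup (Set.finite_range E.τ).bddAbove k

theorem exp_σ_le (hE : E.Admissible) (hγ : 0 ≤ γ) : Real.exp (γ * E.σ) ≤ E.delayFactor γ := by
  refine Real.exp_le_exp.2 (mul_le_mul_of_nonneg_left ?_ hγ)
  have := Finset.sum_nonneg fun k (_ : k ∈ Finset.univ) => (hE.τ_pos k).le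
  linarith

theorem exp_τ_le (hE : E.Admissible) (hγ : 0 ≤ γ) (k : Fin m) :
    Real.exp (γ * E.τ k) ≤ E.delayFactor γ := by
  refine Real.exp_le_exp.2 (mul_le_mul_of_nonneg_left ?_ hγ)
  have := Finset.single_le_sum (fun k (_ : k ∈ Finset.univ) => (hE.τ_pos k).le)
    (Finset.mem_univ k)
  linarith [hE.σ_pos]

end Admissible

theorem delayFactor_pos (E : NeutralEq m) (γ : ℝ) : 0 < E.delayFactor γ := Real.exp_pos _

namespace HasDerivDecay

variable {E : NeutralEq m} {s T γ S C : ℝ} {Ψ x : ℝ → ℝ}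

/-- The weighted bound of the neutral term `x'(g(t))`. -/
theorem ae_abs_xdot_g_le (hE : E.Admissible) (H : E.HasDerivDecay s T γ S C Ψ x) :
    ∀ᵐ t ∂volume.restrict (Icc s T),
      |xdot s Ψ x (E.g t)| ≤ E.delayFactor γ * (C + S) * Real.exp (-γ * (t - s)) := by
  have h1 := H.deriv_le
  have h2 := H.initial_deriv
  have hC := H.bound_nonneg
  have hS := H.data_nonneg
  rw [ae_restrict_iff' measurableSet_Icc, ae_iff] at h1
  rw [ae_restrict_iff' measurableSet_Ico, ae_iff] at h2
  -- The bounds on `x'` and `Ψ` hold off null sets; the preimages of these under `g` are null, so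
  -- the bounds can be evaluated at `g t` for almost every `t`.
  have h1' := hE.g_null _ h1
  have h2' := hE.g_null _ h2
  rw [ae_restrict_iff' measurableSet_Icc]
  filter_upwards [compl_mem_ae_iff.2 h1', compl_mem_ae_iff.2 h2'] with t ht1 ht2 ht
  have ht0 : E.t₀ ≤ t := H.start.trans ht.1
  have hg := hE.g_delay t ht0
  have hG := hE.exp_σ_le H.rate_nonneg
  have hG0 := E.delayFactor_pos γ
  have hexp := Real.exp_pos (-γ * (t - s))
  simp only [mem_compl_iff, mem_ofPred_eq, not_and, not_not] at ht1 ht2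
  unfold xdot
  split_ifs with hlt
  · have hw := exp_le_mul_exp (s := s) (t := t) (u := s) H.rate_nonneg hG (by linarith)
    rw [sub_self, mul_zero, Real.exp_zero] at hw
    have := ht2 ht0 ⟨by linarith [ht.1], hlt⟩
    calc |Ψ (E.g t)| ≤ S * 1 := by linarith
      _ ≤ (C + S) * (E.delayFactor γ * Real.exp (-γ * (t - s))) := by gcongr; linarith
      _ = _ := by ring
  · have hw := exp_le_mul_exp (s := s) (t := t) (u := E.g t) H.rate_nonneg hG hg.2
    have := ht1 ht0 ⟨not_lt.1 hlt, by linarith [ht.2]⟩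
    calc |deriv x (E.g t)| ≤ C * Real.exp (-γ * (E.g t - s)) := this
      _ ≤ (C + S) * (E.delayFactor γ * Real.exp (-γ * (t - s))) := by gcongr; linarith
      _ = _ := by ring

/-- The weighted bound of the error made when the delay is dropped. -/
theorem abs_sub_delay_le (hE : E.Admissible) (H : E.HasDerivDecay s T γ S C Ψ x) (k : Fin m)
    {t : ℝ} (ht : t ∈ Icc s T) :
    |x (E.h k t) - x t| ≤
      E.delayFactor γ * (E.τ k * C + 2 * S) * Real.exp (-γ * (t - s)) := by
  have hC := H.bound_nonneg
  have hS := H.data_nonneg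
  have ht0 : E.t₀ ≤ t := H.start.trans ht.1
  have hh := hE.h_delay k t ht0
  have hG := hE.exp_τ_le H.rate_nonneg k
  have hτ := hE.τ_pos k
  rcases lt_or_ge (E.h k t) s with hlt | hge
  · have hw := exp_le_mul_exp (s := s) (t := t) (u := s) H.rate_nonneg hG (by linarith)
    have h1 := H.absCont.abs_sub_le_of_ae_abs_deriv_le_exp H.rate_nonneg hC H.deriv_le
      le_rfl ht.1 ht.2
    rw [sub_self, mul_zero, Real.exp_zero] at hw h1
    have hm := hE.le_τmax k
    have h2 := H.initial (E.h k t) ⟨by linarith [ht.1], hlt.le⟩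
    have h3 := H.initial s ⟨by linarith [ht.1], le_rfl⟩
    -- The increment is split at `s`: the jump from `h k t` to `s` costs `2 S`, since `Φ` has no
    -- regularity, and the part after `s` costs `C (t - s)` with `t - s ≤ τ k`.
    have h4 : C * 1 * (t - s) ≤ C * 1 * E.τ k := by gcongr; linarith
    calc |x (E.h k t) - x t| ≤ (E.τ k * C + 2 * S) * 1 := by
          rw [abs_le] at h1 h2 h3 ⊢
          constructor <;> linarith [h1.1, h1.2, h2.1, h2.2, h3.1, h3.2]
      _ ≤ (E.τ k * C + 2 * S) * (E.delayFactor γ * Real.exp (-γ * (t - s))) := by gcongr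
      _ = _ := by ring
  · have hw := exp_le_mul_exp (s := s) (t := t) (u := E.h k t) H.rate_nonneg hG hh.2
    have h1 := H.absCont.abs_sub_le_of_ae_abs_deriv_le_exp H.rate_nonneg hC H.deriv_le
      hge (by linarith) ht.2
    rw [abs_sub_comm]
    calc _ ≤ _ := h1
      _ ≤ C * (E.delayFactor γ * Real.exp (-γ * (t - s))) * E.τ k := by
        have := E.delayFactor_pos γ
        gcongr
        · linarith
        · exact hh.2
      _ = (E.τ k * C + 0) * (E.delayFactor γ * Real.exp (-γ * (t - s))) := by ring
      _ ≤ (E.τ k * C + 2 * S) * (E.delayFactor γ * Real.exp (-γ * (t - s))) := by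
        have := E.delayFactor_pos γ
        gcongr
        linarith
      _ = _ := by ring

/-- The weighted bound of the delayed values of a decaying solution. -/
theorem abs_delay_le (hE : E.Admissible) (H : E.HasDerivDecay s T γ S C Ψ x) {N : ℝ}
    (hN0 : 0 ≤ N) (hN : ∀ t ∈ Icc s T, |x t| ≤ N * Real.exp (-γ * (t - s))) (k : Fin m)
    {t : ℝ} (ht : t ∈ Icc s T) :
    |x (E.h k t)| ≤ E.delayFactor γ * (N + S) * Real.exp (-γ * (t - s)) := by
  have hS := H.data_nonneg
  have ht0 : E.t₀ ≤ t := H.start.trans ht.1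
  have hh := hE.h_delay k t ht0
  have hG := hE.exp_τ_le H.rate_nonneg k
  rcases lt_or_ge (E.h k t) s with hlt | hge
  · have hw := exp_le_mul_exp (s := s) (t := t) (u := s) H.rate_nonneg hG (by linarith)
    rw [sub_self, mul_zero, Real.exp_zero] at hw
    have hm := hE.le_τmax k
    have h2 := H.initial (E.h k t) ⟨by linarith [ht.1], hlt.le⟩
    calc |x (E.h k t)| ≤ S * 1 := by linarith
      _ ≤ (N + S) * (E.delayFactor γ * Real.exp (-γ * (t - s))) := by gcongr; linarith
      _ = _ := by ring
  · have hw := exp_le_mul_exp (s := s) (t := t) (u := E.h k t) H.rate_nonneg hG hh.2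
    calc |x (E.h k t)| ≤ N * Real.exp (-γ * (E.h k t - s)) := hN _ ⟨hge, by linarith [ht.2]⟩
      _ ≤ (N + S) * (E.delayFactor γ * Real.exp (-γ * (t - s))) := by gcongr; linarith
      _ = _ := by ring

/-- The equation written with `x'` on the left, with a bound of the neutral term. -/
theorem ae_deriv_eq (H : E.HasDerivDecay s T γ S C Ψ x) :
    ∀ᵐ t ∂volume.restrict (Icc s T),
      deriv x t = E.a t * xdot s Ψ x (E.g t) + ∑ k, E.b k t * x (E.h k t) := by
  filter_upwards [H.equation, ae_restrict_mem measurableSet_Icc] with t ht hmem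
  rw [xdot, if_neg (not_lt.2 hmem.1)] at ht
  linarith

/-- A bound of the distance from the ordinary equation `x' = b x`. -/
theorem ae_abs_deriv_sub_le (hE : E.Admissible) (H : E.HasDerivDecay s T γ S C Ψ x) :
    ∀ᵐ t ∂volume.restrict (Icc s T),
      |deriv x t - E.bSum t * x t| ≤
        (|E.a t| * (C + S) + ∑ k, |E.b k t| * (E.τ k * C + 2 * S)) *
          (E.delayFactor γ * Real.exp (-γ * (t - s))) := by
  filter_upwards [H.ae_deriv_eq, H.ae_abs_xdot_g_le hE, ae_restrict_mem measurableSet_Icc]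
    with t ht hg hmem
  have heq : deriv x t - E.bSum t * x t =
      E.a t * xdot s Ψ x (E.g t) + ∑ k, E.b k t * (x (E.h k t) - x t) := by
    rw [ht, bSum, Finset.sum_mul, add_sub_assoc, ← Finset.sum_sub_distrib]
    simp only [mul_sub]
  rw [heq, add_mul, Finset.sum_mul]
  refine (abs_add_le _ _).trans (add_le_add ?_ ?_)
  · rw [abs_mul, mul_assoc]
    refine mul_le_mul_of_nonneg_left (hg.trans_eq (by ring)) (abs_nonneg _)
  · refine (Finset.abs_sum_le_sum_abs _ _).trans (Finset.sum_le_sum fun k _ => ?_)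
    rw [abs_mul, mul_assoc]
    exact mul_le_mul_of_nonneg_left ((H.abs_sub_delay_le hE k hmem).trans_eq (by ring))
      (abs_nonneg _)

/-- If `b ≤ -β`, the decay of the derivative forces the decay of the solution. -/
theorem abs_le (hE : E.Admissible) (H : E.HasDerivDecay s T γ S C Ψ x) {β α : ℝ} {ρ : Fin m → ℝ}
    (hm : 0 ≤ E.τmax) (hγβ : γ < β) (hα0 : 0 ≤ α) (hρ0 : ∀ k, 0 ≤ ρ k)
    (hb : ∀ᵐ t ∂volume.restrict (Ici E.t₀), E.bSum t ≤ -β)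
    (hα : ∀ᵐ t ∂volume.restrict (Ici E.t₀), |E.a t| ≤ |E.bSum t| * α)
    (hρ : ∀ k, ∀ᵐ t ∂volume.restrict (Ici E.t₀), |E.b k t| ≤ |E.bSum t| * ρ k) :
    ∀ t ∈ Icc s T, |x t| ≤
      (S + E.delayFactor γ * ((α + ∑ k, E.τ k * ρ k) * C + (α + 2 * ∑ k, ρ k) * S)) *
        (β / (β - γ)) * Real.exp (-γ * (t - s)) := by
  have hC := H.bound_nonneg
  have hS := H.data_nonneg
  have hγ := H.rate_nonneg
  have hG := E.delayFactor_pos γ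
  have hβγ : 0 < β - γ := by linarith
  have hss : Icc s T ⊆ Ici E.t₀ := fun t ht => H.start.trans ht.1
  have hκ : 0 ≤ ∑ k, E.τ k * ρ k :=
    Finset.sum_nonneg fun k _ => mul_nonneg (hE.τ_pos k).le (hρ0 k)
  have hκ' : 0 ≤ ∑ k, ρ k := Finset.sum_nonneg fun k _ => hρ0 k
  set K := E.delayFactor γ * ((α + ∑ k, E.τ k * ρ k) * C + (α + 2 * ∑ k, ρ k) * S) with hK
  have hK0 : 0 ≤ K := by positivity
  have hδ : 1 ≤ β / (β - γ) := by rw [one_le_div hβγ]; linarith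
  have hSK : S + K ≤ (S + K) * (β / (β - γ)) := le_mul_of_one_le_right (by linarith) hδ
  -- The comparison needs `N (β - γ) ≥ β K`, and `N ≥ S` at the start; `N = (S + K) β / (β - γ)`
  -- meets both.
  have hNeq : (S + K) * (β / (β - γ)) * (β - γ) = (S + K) * β := by field_simp
  refine H.absCont.abs_le_exp_of_ae_abs_deriv_sub_le (p := E.bSum) (β := β) (K := K)
    (ae_restrict_of_ae_restrict_of_subset hss hb) ?_ (by linarith) (by linarith) ?_ ?_
  · filter_upwards [H.ae_abs_deriv_sub_le hE, ae_restrict_of_ae_restrict_of_subset hss hα,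
      ae_all_iff.2 fun k => ae_restrict_of_ae_restrict_of_subset hss (hρ k)] with t h1 h2 h3
    refine h1.trans ?_
    -- The whole error carries the factor `|b(t)|`, so no upper bound of `|b|` enters the estimate
    -- of `x`.
    calc _ ≤ (|E.bSum t| * α * (C + S) + ∑ k, |E.bSum t| * ρ k * (E.τ k * C + 2 * S)) *
          (E.delayFactor γ * Real.exp (-γ * (t - s))) := by
          gcongr with k
          · have := hE.τ_pos k
            positivity
          · exact h3 k
      _ = _ := by
        have : ∑ k, |E.bSum t| * ρ k * (E.τ k * C + 2 * S) =
            |E.bSum t| * ((∑ k, E.τ k * ρ k) * C + 2 * (∑ k, ρ k) * S) := by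
          simp only [Finset.sum_mul, Finset.mul_sum, ← Finset.sum_add_distrib]
          exact Finset.sum_congr rfl fun k _ => by ring
        rw [this, hK]; ring
  · nlinarith
  · exact (H.initial s ⟨by linarith, le_rfl⟩).trans (by linarith)

/-- The first bootstrap of the bound of the derivative, with the terms `x(h k (t))` kept. -/
theorem ae_abs_deriv_le_of_delayed (hE : E.Admissible) (H : E.HasDerivDecay s T γ S C Ψ x)
    {N A : ℝ} {B : Fin m → ℝ} (hN0 : 0 ≤ N)
    (hN : ∀ t ∈ Icc s T, |x t| ≤ N * Real.exp (-γ * (t - s)))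
    (hA : ∀ᵐ t ∂volume.restrict (Ici E.t₀), |E.a t| ≤ A)
    (hB : ∀ k, ∀ᵐ t ∂volume.restrict (Ici E.t₀), |E.b k t| ≤ B k) :
    ∀ᵐ t ∂volume.restrict (Icc s T), |deriv x t| ≤
      E.delayFactor γ * (A * (C + S) + (∑ k, B k) * (N + S)) * Real.exp (-γ * (t - s)) := by
  have hC := H.bound_nonneg
  have hS := H.data_nonneg
  have hG := E.delayFactor_pos γ
  have hss : Icc s T ⊆ Ici E.t₀ := fun t ht => H.start.trans ht.1
  filter_upwards [H.ae_deriv_eq, H.ae_abs_xdot_g_le hE, ae_restrict_mem measurableSet_Icc,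
    ae_restrict_of_ae_restrict_of_subset hss hA,
    ae_all_iff.2 fun k => ae_restrict_of_ae_restrict_of_subset hss (hB k)] with t ht hg hmem hAt hBt
  rw [ht]
  calc _ ≤ |E.a t| * |xdot s Ψ x (E.g t)| + ∑ k, |E.b k t| * |x (E.h k t)| := by
        refine (abs_add_le _ _).trans (add_le_add (abs_mul _ _).le ?_)
        exact (Finset.abs_sum_le_sum_abs _ _).trans_eq (by simp only [abs_mul])
    _ ≤ A * (E.delayFactor γ * (C + S) * Real.exp (-γ * (t - s))) +
        ∑ k, B k * (E.delayFactor γ * (N + S) * Real.exp (-γ * (t - s))) := by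
        gcongr with k
        · exact (abs_nonneg _).trans hAt
        · exact (abs_nonneg _).trans (hBt k)
        · exact hBt k
        · exact H.abs_delay_le hE hN0 hN k hmem
    _ = _ := by rw [← Finset.sum_mul]; ring

/-- The second bootstrap of the bound of the derivative, through the ordinary equation. -/
theorem ae_abs_deriv_le_of_bSum (hE : E.Admissible) (H : E.HasDerivDecay s T γ S C Ψ x)
    {N A D : ℝ} {B : Fin m → ℝ}
    (hN : ∀ t ∈ Icc s T, |x t| ≤ N * Real.exp (-γ * (t - s)))
    (hA : ∀ᵐ t ∂volume.restrict (Ici E.t₀), |E.a t| ≤ A)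
    (hB : ∀ k, ∀ᵐ t ∂volume.restrict (Ici E.t₀), |E.b k t| ≤ B k)
    (hD : ∀ᵐ t ∂volume.restrict (Ici E.t₀), |E.bSum t| ≤ D) :
    ∀ᵐ t ∂volume.restrict (Icc s T), |deriv x t| ≤
      (D * N + E.delayFactor γ * (A * (C + S) + (∑ k, E.τ k * B k) * C + 2 * (∑ k, B k) * S)) *
        Real.exp (-γ * (t - s)) := by
  have hC := H.bound_nonneg
  have hS := H.data_nonneg
  have hG := E.delayFactor_pos γ
  have hss : Icc s T ⊆ Ici E.t₀ := fun t ht => H.start.trans ht.1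
  filter_upwards [H.ae_abs_deriv_sub_le hE, ae_restrict_mem measurableSet_Icc,
    ae_restrict_of_ae_restrict_of_subset hss hA, ae_restrict_of_ae_restrict_of_subset hss hD,
    ae_all_iff.2 fun k => ae_restrict_of_ae_restrict_of_subset hss (hB k)]
    with t ht hmem hAt hDt hBt
  calc |deriv x t| ≤ |E.bSum t| * |x t| + |deriv x t - E.bSum t * x t| := by
        rw [← abs_mul]
        exact (congrArg _ (by ring)).trans_le (abs_add_le _ _)
    _ ≤ D * (N * Real.exp (-γ * (t - s))) +
        (A * (C + S) + ∑ k, B k * (E.τ k * C + 2 * S)) *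
          (E.delayFactor γ * Real.exp (-γ * (t - s))) := by
        refine add_le_add (mul_le_mul hDt (hN t hmem) (abs_nonneg _) ((abs_nonneg _).trans hDt))
          (ht.trans ?_)
        gcongr with k
        · have := hE.τ_pos k
          positivity
        · exact hBt k
    _ = _ := by
      have : ∑ k, B k * (E.τ k * C + 2 * S) = (∑ k, E.τ k * B k) * C + 2 * (∑ k, B k) * S := by
        simp only [Finset.sum_mul, Finset.mul_sum, ← Finset.sum_add_distrib]
        exact Finset.sum_congr rfl fun k _ => by ring
      rw [this]; ring

end HasDerivDecay

end NeutralEq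

/-! ### From the bootstrap to uniform exponential stability. -/

namespace NeutralEq

variable {m : ℕ}

/-- Uniform exponential stability follows once every bound `C` of the weighted derivative improves
to `θ C + η S` with `θ < 1`, where `S` bounds the initial data. -/
theorem Admissible.uniformlyExponentiallyStable_of_bootstrap {E : NeutralEq m} (hE : E.Admissible)
    {β γ θ η α : ℝ} {ρ : Fin m → ℝ}
    (hγ : 0 < γ) (hγβ : γ < β) (hα0 : 0 ≤ α) (hρ0 : ∀ k, 0 ≤ ρ k)
    (hb : ∀ᵐ t ∂volume.restrict (Ici E.t₀), E.bSum t ≤ -β)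
    (hα : ∀ᵐ t ∂volume.restrict (Ici E.t₀), |E.a t| ≤ |E.bSum t| * α)
    (hρ : ∀ k, ∀ᵐ t ∂volume.restrict (Ici E.t₀), |E.b k t| ≤ |E.bSum t| * ρ k)
    (hθ0 : 0 ≤ θ) (hθ : θ < 1) (hη : 0 ≤ η)
    (hstep : ∀ {s T S C : ℝ} {Ψ x : ℝ → ℝ}, E.HasDerivDecay s T γ S C Ψ x →
      ∀ᵐ t ∂volume.restrict (Icc s T), |deriv x t| ≤ (θ * C + η * S) * Real.exp (-γ * (t - s))) :
    E.UniformlyExponentiallyStable := by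
  have hτ : 0 ≤ E.τmax := Real.iSup_nonneg fun k => (hE.τ_pos k).le
  have hG := E.delayFactor_pos γ
  have hκ : 0 ≤ ∑ k, E.τ k * ρ k :=
    Finset.sum_nonneg fun k _ => mul_nonneg (hE.τ_pos k).le (hρ0 k)
  have hκ' : 0 ≤ ∑ k, ρ k := Finset.sum_nonneg fun k _ => hρ0 k
  have hθ' : 0 < 1 - θ := by linarith
  have hβγ : 0 < β - γ := by linarith
  have hβ : 0 < β := by linarith
  -- This `M` is the constant of `HasDerivDecay.abs_le` for `C = η S / (1 - θ)`, with `S` factored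
  -- out.
  refine ⟨(1 + E.delayFactor γ * ((α + ∑ k, E.τ k * ρ k) * (η / (1 - θ)) + (α + 2 * ∑ k, ρ k))) *
    (β / (β - γ)), γ, by positivity, hγ, ?_⟩
  intro s hs Φ Ψ x hI hx t hst
  set P := ⨆ r : Icc (s - E.τmax) s, |Φ r| with hP
  set Q := essSup (fun r => |Ψ r|) (volume.restrict (Ico (s - E.σ) s)) with hQ
  have hPle : ∀ r ∈ Icc (s - E.τmax) s, |Φ r| ≤ P := by
    obtain ⟨c, hc⟩ := hI.Φ_bound
    intro r hr
    exact le_ciSup (f := fun r : Icc (s - E.τmax) s => |Φ r|)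
      ⟨c, by rintro _ ⟨r, rfl⟩; exact hc r r.2⟩ ⟨r, hr⟩
  have hQle : ∀ᵐ r ∂volume.restrict (Ico (s - E.σ) s), |Ψ r| ≤ Q := by
    obtain ⟨c, hc⟩ := hI.Ψ_bound
    exact ae_abs_le_essSup ⟨c, (ae_restrict_mem measurableSet_Ico).mono hc⟩
  have hP0 : 0 ≤ P := (abs_nonneg _).trans (hPle s ⟨by linarith, le_rfl⟩)
  have hQ0 : 0 ≤ Q := by
    have : NeZero (volume.restrict (Ico (s - E.σ) s)) := by
      refine ⟨fun h => ?_⟩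
      rw [Measure.restrict_eq_zero, Real.volume_Ico, ENNReal.ofReal_eq_zero] at h
      linarith [hE.σ_pos]
    obtain ⟨r, hr⟩ := hQle.exists
    exact (abs_nonneg _).trans hr
  -- The right end is `t + 1` because regularity of `x` is given on `[s, c]` only for `s < c`, while
  -- `t = s` is allowed.
  have hss : Icc s (t + 1) ⊆ Ici s := fun r hr => hr.1
  have hdecay : ∀ C, 0 ≤ C →
      (∀ᵐ r ∂volume.restrict (Icc s (t + 1)), |deriv x r| ≤ C * Real.exp (-γ * (r - s))) →
      E.HasDerivDecay s (t + 1) γ (P + Q) C Ψ x := fun C hC hd =>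
    { start := hs
      rate_nonneg := hγ.le
      data_nonneg := add_nonneg hP0 hQ0
      bound_nonneg := hC
      absCont := hx.absCont _ (by linarith)
      initial := fun r hr => by
        rw [hx.initial r hr]
        linarith [hPle r hr]
      initial_deriv := hQle.mono fun r hr => by linarith
      equation := ae_restrict_of_ae_restrict_of_subset hss hx.equation
      deriv_le := hd }
  have hS : 0 ≤ P + Q := add_nonneg hP0 hQ0
  have hfinal : ∀ᵐ r ∂volume.restrict (Icc s (t + 1)),
      |deriv x r| ≤ η * (P + Q) / (1 - θ) * Real.exp (-γ * (r - s)) := by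
    refine ae_le_mul_of_contraction hθ0 hθ (mul_nonneg hη hS) ?_
      fun C hC hd => hstep (hdecay C hC hd)
    obtain ⟨c, hc⟩ := hx.deriv_bound (t + 1) (by linarith)
    -- This initial constant depends on `x` and `t`, which is harmless because the contraction
    -- removes it.
    refine ⟨|c| * Real.exp (γ * (t + 1 - s)), by positivity, ?_⟩
    filter_upwards [hc, ae_restrict_mem measurableSet_Icc] with r hr hmem
    rw [mul_assoc, ← Real.exp_add]
    refine (hr.trans (le_abs_self c)).trans (le_mul_of_one_le_right (abs_nonneg c) ?_)
    exact Real.one_le_exp (by nlinarith [hmem.2])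
  refine ((hdecay _ (by positivity) hfinal).abs_le hE hτ hγβ hα0 hρ0 hb hα hρ t
    ⟨hst, by linarith⟩).trans_eq ?_
  ring

/-! ### Essential supremum norms and the choice of the rate. -/

theorem ae_abs_le_supNorm (E : NeutralEq m) {f : ℝ → ℝ}
    (hf : ∃ C : ℝ, ∀ᵐ t ∂volume.restrict (Ici E.t₀), |f t| ≤ C) :
    ∀ᵐ t ∂volume.restrict (Ici E.t₀), |f t| ≤ E.supNorm f :=
  ae_abs_le_essSup hf

theorem supNorm_nonneg (E : NeutralEq m) {f : ℝ → ℝ}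
    (hf : ∃ C : ℝ, ∀ᵐ t ∂volume.restrict (Ici E.t₀), |f t| ≤ C) : 0 ≤ E.supNorm f := by
  have : NeZero (volume.restrict (Ici E.t₀)) := ⟨by simp [Measure.restrict_eq_zero]⟩
  obtain ⟨t, ht⟩ := (E.ae_abs_le_supNorm hf).exists
  exact (abs_nonneg _).trans ht

/-- Division by a function bounded away from zero preserves essential boundedness. -/
theorem exists_ae_abs_div_bSum_le {E : NeutralEq m} {β : ℝ} (hβ : 0 < β)
    (hb : ∀ᵐ t ∂volume.restrict (Ici E.t₀), E.bSum t ≤ -β) {f : ℝ → ℝ}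
    (hf : ∃ C : ℝ, ∀ᵐ t ∂volume.restrict (Ici E.t₀), |f t| ≤ C) :
    ∃ C : ℝ, ∀ᵐ t ∂volume.restrict (Ici E.t₀), |f t / E.bSum t| ≤ C := by
  obtain ⟨C, hC⟩ := hf
  refine ⟨C / β, ?_⟩
  filter_upwards [hb, hC] with t h1 h2
  rw [abs_div]
  exact div_le_div₀ ((abs_nonneg _).trans h2) h2 hβ (by rw [abs_of_neg] <;> linarith)

/-- Converts the norms `‖a/b‖` and `‖b_k/b‖` into the pointwise domination by `|b(t)|` that the
comparison with `x' = b x` uses; `b ≤ -β < 0` makes the division legitimate. -/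
theorem ae_abs_le_abs_bSum_mul {E : NeutralEq m} {β : ℝ} (hβ : 0 < β)
    (hb : ∀ᵐ t ∂volume.restrict (Ici E.t₀), E.bSum t ≤ -β) {f : ℝ → ℝ}
    (hf : ∃ C : ℝ, ∀ᵐ t ∂volume.restrict (Ici E.t₀), |f t| ≤ C) :
    ∀ᵐ t ∂volume.restrict (Ici E.t₀), |f t| ≤
      |E.bSum t| * E.supNorm (fun t => f t / E.bSum t) := by
  filter_upwards [hb, E.ae_abs_le_supNorm (exists_ae_abs_div_bSum_le hβ hb hf)] with t h1 h2
  rw [abs_div, div_le_iff₀ (by rw [abs_pos]; linarith)] at h2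
  rwa [mul_comm]

/-- A function of the rate and the delay factor that is continuous and less than `1` at the
rate `0` is less than `1` for some small positive rate. -/
theorem exists_rate (E : NeutralEq m) {β : ℝ} (hβ : 0 < β) {F : ℝ → ℝ → ℝ}
    (hF : Continuous fun p : ℝ × ℝ => F p.1 p.2) (h1 : F 1 1 < 1) :
    ∃ γ, 0 < γ ∧ γ < β ∧ F (E.delayFactor γ) (β / (β - γ)) < 1 := by
  have hδ : ContinuousAt (fun γ : ℝ => (E.delayFactor γ, β / (β - γ))) 0 := by
    refine ContinuousAt.prodMk ?_ ?_
    · unfold delayFactor; fun_prop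
    · exact continuousAt_const.div (by fun_prop) (by simpa using hβ.ne')
  have hc : ContinuousAt (fun γ : ℝ => F (E.delayFactor γ) (β / (β - γ))) 0 :=
    hF.continuousAt.comp (f := fun γ : ℝ => (E.delayFactor γ, β / (β - γ))) hδ
  have hev : ∀ᶠ γ in 𝓝 (0 : ℝ), F (E.delayFactor γ) (β / (β - γ)) < 1 :=
    hc.eventually_lt_const (by simpa [delayFactor, hβ.ne'] using h1)
  obtain ⟨γ, ⟨h2, h3⟩, h4⟩ := (((hev.and (eventually_lt_nhds hβ)).filter_mono
    nhdsWithin_le_nhds).and (self_mem_nhdsWithin (s := Ioi (0 : ℝ)))).exists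
  exact ⟨γ, h4, h3, h2⟩

/-! ### The two smallness criteria. -/

/-- Stability under a smallness condition on the sum of the bounds of the `b k`. -/
theorem Admissible.uniformlyExponentiallyStable_of_sum_bound {E : NeutralEq m}
    (hE : E.Admissible) {β A α : ℝ} {B ρ : Fin m → ℝ} (hβ : 0 < β)
    (hA0 : 0 ≤ A) (hα0 : 0 ≤ α) (hB0 : ∀ k, 0 ≤ B k) (hρ0 : ∀ k, 0 ≤ ρ k)
    (hb : ∀ᵐ t ∂volume.restrict (Ici E.t₀), E.bSum t ≤ -β)
    (hA : ∀ᵐ t ∂volume.restrict (Ici E.t₀), |E.a t| ≤ A)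
    (hB : ∀ k, ∀ᵐ t ∂volume.restrict (Ici E.t₀), |E.b k t| ≤ B k)
    (hα : ∀ᵐ t ∂volume.restrict (Ici E.t₀), |E.a t| ≤ |E.bSum t| * α)
    (hρ : ∀ k, ∀ᵐ t ∂volume.restrict (Ici E.t₀), |E.b k t| ≤ |E.bSum t| * ρ k)
    (h : (∑ k, B k) * (α + ∑ k, E.τ k * ρ k) < 1 - A) :
    E.UniformlyExponentiallyStable := by
  have hτ : 0 ≤ E.τmax := Real.iSup_nonneg fun k => (hE.τ_pos k).le
  have hκ : 0 ≤ ∑ k, E.τ k * ρ k :=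
    Finset.sum_nonneg fun k _ => mul_nonneg (hE.τ_pos k).le (hρ0 k)
  have hR : 0 ≤ ∑ k, ρ k := Finset.sum_nonneg fun k _ => hρ0 k
  have hB1 : 0 ≤ ∑ k, B k := Finset.sum_nonneg fun k _ => hB0 k
  have hW : 0 ≤ ∑ k, E.τ k * B k :=
    Finset.sum_nonneg fun k _ => mul_nonneg (hE.τ_pos k).le (hB0 k)
  -- `F` is the coefficient of `C` once the bound of `x` is inserted into that of `x'`, with `G` the
  -- delay factor and `δ = β / (β - γ)`; `η` below collects the coefficient of `S`. For `G = δ = 1`,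
  -- `F < 1` is the assumption `h`.
  obtain ⟨γ, hγ, hγβ, hθ⟩ := E.exists_rate hβ
    (F := fun G δ => G * (A + (∑ k, B k) * (G * (α + ∑ k, E.τ k * ρ k) * δ))) (by fun_prop)
    (by linarith)
  have hG := E.delayFactor_pos γ
  have hδ : 0 < β / (β - γ) := div_pos hβ (by linarith)
  refine hE.uniformlyExponentiallyStable_of_bootstrap hγ hγβ hα0 hρ0 hb hα hρ (by positivity) hθ
    (η := E.delayFactor γ * (A + (∑ k, B k) *
      ((1 + E.delayFactor γ * (α + 2 * ∑ k, ρ k)) * (β / (β - γ)) + 1)))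
    (by positivity) ?_
  intro s T S C Ψ x H
  have hC := H.bound_nonneg
  have hS := H.data_nonneg
  filter_upwards [H.ae_abs_deriv_le_of_delayed hE (by positivity)
    (H.abs_le hE hτ hγβ hα0 hρ0 hb hα hρ) hA hB] with t ht
  exact ht.trans_eq (by ring)

/-- Stability under a smallness condition on the bound of the sum of the `b k`. -/
theorem Admissible.uniformlyExponentiallyStable_of_bSum_bound {E : NeutralEq m}
    (hE : E.Admissible) {β A α D : ℝ} {B ρ : Fin m → ℝ} (hβ : 0 < β)
    (hA0 : 0 ≤ A) (hα0 : 0 ≤ α) (hB0 : ∀ k, 0 ≤ B k) (hρ0 : ∀ k, 0 ≤ ρ k) (hD0 : 0 ≤ D)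
    (hb : ∀ᵐ t ∂volume.restrict (Ici E.t₀), E.bSum t ≤ -β)
    (hA : ∀ᵐ t ∂volume.restrict (Ici E.t₀), |E.a t| ≤ A)
    (hB : ∀ k, ∀ᵐ t ∂volume.restrict (Ici E.t₀), |E.b k t| ≤ B k)
    (hD : ∀ᵐ t ∂volume.restrict (Ici E.t₀), |E.bSum t| ≤ D)
    (hα : ∀ᵐ t ∂volume.restrict (Ici E.t₀), |E.a t| ≤ |E.bSum t| * α)
    (hρ : ∀ k, ∀ᵐ t ∂volume.restrict (Ici E.t₀), |E.b k t| ≤ |E.bSum t| * ρ k)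
    (h : D * (α + ∑ k, E.τ k * ρ k) < 1 - A - ∑ k, E.τ k * B k) :
    E.UniformlyExponentiallyStable := by
  have hτ : 0 ≤ E.τmax := Real.iSup_nonneg fun k => (hE.τ_pos k).le
  have hκ : 0 ≤ ∑ k, E.τ k * ρ k :=
    Finset.sum_nonneg fun k _ => mul_nonneg (hE.τ_pos k).le (hρ0 k)
  have hR : 0 ≤ ∑ k, ρ k := Finset.sum_nonneg fun k _ => hρ0 k
  have hB1 : 0 ≤ ∑ k, B k := Finset.sum_nonneg fun k _ => hB0 k
  have hW : 0 ≤ ∑ k, E.τ k * B k :=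
    Finset.sum_nonneg fun k _ => mul_nonneg (hE.τ_pos k).le (hB0 k)
  -- Here `x'` is bounded through `b x` plus the error: `D` multiplies the bound of `x`, and the
  -- error contributes `G (A + ∑ τ_k B_k)`.
  obtain ⟨γ, hγ, hγβ, hθ⟩ := E.exists_rate hβ
    (F := fun G δ => D * (G * (α + ∑ k, E.τ k * ρ k) * δ) + G * (A + ∑ k, E.τ k * B k)) (by fun_prop)
    (by linarith)
  have hG := E.delayFactor_pos γ
  have hδ : 0 < β / (β - γ) := div_pos hβ (by linarith)
  refine hE.uniformlyExponentiallyStable_of_bootstrap hγ hγβ hα0 hρ0 hb hα hρ (by positivity) hθ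
    (η := D * ((1 + E.delayFactor γ * (α + 2 * ∑ k, ρ k)) * (β / (β - γ))) +
      E.delayFactor γ * (A + 2 * ∑ k, B k))
    (by positivity) ?_
  intro s T S C Ψ x H
  filter_upwards [H.ae_abs_deriv_le_of_bSum hE
    (H.abs_le hE hτ hγβ hα0 hρ0 hb hα hρ) hA hB hD] with t ht
  exact ht.trans_eq (by ring)

end NeutralEq

open NeutralEq
theorem mainTheorem11 {m : ℕ} (E : NeutralEq m) (hE : E.Admissible)
    (β : ℝ) (hβ : 0 < β)
    (hb : ∀ᵐ t ∂volume.restrict (Ici E.t₀), E.bSum t ≤ -β)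
    (hcond :
      (∑ k, E.supNorm (E.b k)) *
          (E.supNorm (fun t => E.a t / E.bSum t) +
            ∑ k, E.τ k * E.supNorm (fun t => E.b k t / E.bSum t))
        < 1 - E.supNorm E.a ∨
      E.supNorm E.bSum *
          (E.supNorm (fun t => E.a t / E.bSum t) +
            ∑ k, E.τ k * E.supNorm (fun t => E.b k t / E.bSum t))
        < 1 - E.supNorm E.a - ∑ k, E.τ k * E.supNorm (E.b k)) :
    E.UniformlyExponentiallyStable := by
  -- Essential boundedness has to be supplied for each function, since a real-valued essential
  -- supremum need not bound an unbounded function.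
  have ha' : ∃ C : ℝ, ∀ᵐ t ∂volume.restrict (Ici E.t₀), |E.a t| ≤ C :=
    hE.a_bound.imp fun _ h => h.2
  have hbSum' : ∃ C : ℝ, ∀ᵐ t ∂volume.restrict (Ici E.t₀), |E.bSum t| ≤ C := by
    choose c hc using hE.b_bound
    refine ⟨∑ k, c k, ?_⟩
    filter_upwards [ae_all_iff.2 hc] with t ht
    exact (Finset.abs_sum_le_sum_abs _ _).trans (Finset.sum_le_sum fun k _ => ht k)
  have hA := E.ae_abs_le_supNorm ha'
  have hA0 := E.supNorm_nonneg ha'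
  have hB := fun k => E.ae_abs_le_supNorm (hE.b_bound k)
  have hB0 := fun k => E.supNorm_nonneg (hE.b_bound k)
  have hD := E.ae_abs_le_supNorm hbSum'
  have hD0 := E.supNorm_nonneg hbSum'
  have hα := ae_abs_le_abs_bSum_mul hβ hb ha'
  have hα0 := E.supNorm_nonneg (exists_ae_abs_div_bSum_le hβ hb ha')
  have hρ := fun k => ae_abs_le_abs_bSum_mul hβ hb (hE.b_bound k)
  have hρ0 := fun k => E.supNorm_nonneg (exists_ae_abs_div_bSum_le hβ hb (hE.b_bound k))
  rcases hcond with h | h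
  · exact hE.uniformlyExponentiallyStable_of_sum_bound hβ hA0 hα0 hB0 hρ0 hb hA hB hα hρ h
  · exact hE.uniformlyExponentiallyStable_of_bSum_bound hβ hA0 hα0 hB0 hρ0 hD0 hb hA hB hD hα hρ h
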